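/- Let $\sigma$ be a relational signature all of whose relations are unary or binary. **Conventions.** A *fact* $F$ is a finite non-empty conjunction of $\sigma$-atoms over variables; a *witness* $\mathcal W$ of $F$ in an interpretation $\mathcal J$ is an assignment of the variables of $F$ to elements of $\mathcal J$ making all atoms of $F$ true, and $\mathrm{dom}(\mathcal W)$ is its range. A CQ is an existentially closed finite conjunction of $\sigma$-atoms. $\mathrm{GC}^2$ is the two-variable guarded fragment with equality and counting: Boolean combinations of atoms, closed under $\exists x\,\varphi$ for $\varphi$ with at most one free variable, and under $\exists^{\ge n}x\,(\gamma\wedge\varphi)$ where $\gamma$ is an atom containing both variables. A *guarded pair* of $\mathcal J$ is a pair of distinct elements that co-occur in a tuple of $\mathcal J$; guarded pairs are the edges of the Gaifman graph, and give the neighbors of an element. $\mathcal J|_S$ denotes the interpretation induced by $\mathcal J$ on $S$. The *bags* of $\mathcal J$ are the $\mathcal J|_{\{a,b\}}$ with $\{a,b\}$ a guarded pair, to which one adds a separate *fact bag* $\mathcal J|_{\mathrm{dom}(\mathcal W)}$. An interpretation is *cycle-free except for* $\mathcal W$ if every simple cycle of its Gaifman graph visits only elements of $\mathrm{dom}(\mathcal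 W)$. A *tree-like interpretation* $T$ is a rooted directed tree whose nodes are interpretations (its bags), such that every element of $T$ is *introduced* in some bag $b$, i.e. it occurs in $b$ and otherwise only in children of $b$; a bag shares exactly one element with each child, and this element is introduced in it; and for a non-root bag the shared element is the same for all children. $T$ is identified with the union of its bags. It is an *unraveling* of $\mathcal J$ preserving $\mathcal W$ if its root bag is the fact bag, all other bags have exactly two elements, and all elements of $T$ outside $\mathrm{dom}(\mathcal W)$ are fresh. It is *faithful* if there are a homomorphism $\pi:T\to\mathcal J$ and a map $\phi$ from the bags of $T$ to the bags of $\mathcal J$, sending the root and no other bag to the fact bag, such that: $\pi$ restricts to an isomorphism from each bag $b$ to $\phi(b)$, and to the identity on the root bag; for every $a\in\mathrm{dom}(T)$, $\pi$ restricts to a bijection from the neighbors of $a$ in $T$ to the neighbors of $\pi(a)$ in $\mathcal J$, and for each neighbor $a'$ of $a$ to an isomorphism from $T|_{\{a,a'\}}$ to $\mathcal J|_{\{\pi(a),\pi(a')\}}$; and every non-fact bag of $\mathcal J$ whose domain is not contained in $\mathrm{dom}(\mathcal W)$ is $\phi(b)$ for some $b$. **Statement.** Let $\Theta$ be a set of $\mathrm{GC}^2$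 sentences over $\sigma$, $q$ a CQ over $\sigma$, $F$ a fact over $\sigma$, and let $\mathcal J$ be an interpretation satisfying $\Theta$ and $\neg q$ that has a witness $\mathcal W$ of $F$. Then there are an expansion $\mathcal J'$ of $\mathcal J$ by one fresh binary relation and a tree-like interpretation $T$ that is a faithful unraveling of $\mathcal J'$ preserving $\mathcal W$, such that the restriction of $T$ to $\sigma$ satisfies $\Theta$ and $\neg q$, still has $\mathcal W$ as a witness of $F$, and is cycle-free except for $\mathcal W$. -/

import Mathlib

namespace GuardedUnraveling

universe u v w

/-! ## Signatures of arity at most two and interpretations -/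

/-- A relational signature whose relations are unary or binary. -/
structure Signature where
  /-- the unary relation names -/
  Un : Type u
  /-- the binary relation names -/
  Bin : Type u

/-- An interpretation of `σ` whose domain is the type `A`. -/
structure Interp (σ : Signature.{u}) (A : Type v) where
  un : σ.Un → A → Prop
  bin : σ.Bin → A → A → Prop

/-- The signature `σ` with one fresh binary relation, named `none`. -/
def Signature.addBin (σ : Signature.{u}) : Signature.{u} where
  Un := σ.Un
  Bin := Option σ.Bin

/-- The restriction to `σ` of an interpretation of `σ.addBin`. -/
def Interp.reduct {σ : Signature.{u}} {A : Type v} (J : Interp σ.addBin A) : Interp σ A where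
  un := J.un
  bin R := J.bin (some R)

/-! ## Conjunctions of atoms: facts, conjunctive queries, witnesses -/

/-- Atoms over the variables `V`. -/
inductive Atom (σ : Signature.{u}) (V : Type) where
  | un (P : σ.Un) (x : V)
  | bin (R : σ.Bin) (x y : V)

/-- The set of variables of an atom. -/
def Atom.vars {σ : Signature.{u}} {V : Type} : Atom σ V → Set V
  | .un _ x => {x}
  | .bin _ x y => {x, y}

/-- Truth of an atom under an assignment. -/
def Atom.Holds {σ : Signature.{u}} {V : Type} {A : Type v} (J : Interp σ A) (f : V → A) :
    Atom σ V → Prop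
  | .un P x => J.un P (f x)
  | .bin R x y => J.bin R (f x) (f y)

/-- A finite conjunction of atoms over finitely many variables, each of which occurs in it. -/
structure ConjAtoms (σ : Signature.{u}) where
  /-- the number of variables -/
  n : ℕ
  atoms : List (Atom σ (Fin n))
  occurs : ∀ x : Fin n, ∃ α ∈ atoms, x ∈ α.vars

/-- `f` maps the variables of the fact `F` to elements of `J` so that all atoms of `F` hold.
The domain of this witness is `Set.range f`. -/
def IsWitness {σ : Signature.{u}} {A : Type v} (J : Interp σ A) (F : ConjAtoms σ)
    (f : Fin F.n → A) : Prop :=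
  ∀ α ∈ F.atoms, α.Holds J f

/-- `J` satisfies the Boolean conjunctive query that existentially closes the conjunction `q`. -/
def SatCQ {σ : Signature.{u}} {A : Type v} (J : Interp σ A) (q : ConjAtoms σ) : Prop :=
  ∃ f : Fin q.n → A, ∀ α ∈ q.atoms, α.Holds J f

/-! ## The two-variable guarded fragment with counting quantifiers -/

/-- Two-variable first-order formulas with equality and counting quantifiers; the two variables
are the elements of `Fin 2`, and `exGe n x φ` is `∃^{≥ n} x, φ`. The other connectives and the
quantifiers `∀`, `∃^{≤ n}`, `∃^{= n}` are the usual abbreviations. -/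
inductive Formula (σ : Signature.{u}) where
  | falsum
  | eq (x y : Fin 2)
  | un (P : σ.Un) (x : Fin 2)
  | bin (R : σ.Bin) (x y : Fin 2)
  | neg (φ : Formula σ)
  | and (φ ψ : Formula σ)
  | exGe (n : ℕ) (x : Fin 2) (φ : Formula σ)

namespace Formula

variable {σ : Signature.{u}}

/-- The free variables of a formula. -/
def free : Formula σ → Set (Fin 2)
  | falsum => ∅
  | eq x y => {x, y}
  | un _ x => {x}
  | bin _ x y => {x, y}
  | neg φ => φ.free
  | and φ ψ => φ.free ∪ ψ.free
  | exGe _ x φ => φ.free \ {x}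

/-- Truth of a formula under an assignment of the two variables. -/
def Sat {A : Type v} (J : Interp σ A) : Formula σ → (Fin 2 → A) → Prop
  | falsum, _ => False
  | eq x y, e => e x = e y
  | un P x, e => J.un P (e x)
  | bin R x y, e => J.bin R (e x) (e y)
  | neg φ, e => ¬ φ.Sat J e
  | and φ ψ, e => φ.Sat J e ∧ ψ.Sat J e
  | exGe n x φ, e => (n : ℕ∞) ≤ Set.encard {a : A | φ.Sat J (Function.update e x a)}

/-- Guards for a pair of distinct variables: atoms in which both occur. -/
inductive IsGuard : Formula σ → Prop
  | eq {x y : Fin 2} (h : x ≠ y) : IsGuard (eq x y)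
  | bin (R : σ.Bin) {x y : Fin 2} (h : x ≠ y) : IsGuard (bin R x y)

/-- Membership in the guarded fragment: plain quantification is allowed over formulas with at most
one free variable, and counting quantification over formulas that are guarded by an atom
containing both variables. -/
inductive IsGC2 : Formula σ → Prop
  | falsum : IsGC2 falsum
  | eq (x y : Fin 2) : IsGC2 (eq x y)
  | un (P : σ.Un) (x : Fin 2) : IsGC2 (un P x)
  | bin (R : σ.Bin) (x y : Fin 2) : IsGC2 (bin R x y)
  | neg {φ : Formula σ} (h : IsGC2 φ) : IsGC2 (neg φ)
  | and {φ ψ : Formula σ} (h₁ : IsGC2 φ) (h₂ : IsGC2 ψ) : IsGC2 (and φ ψ)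
  | ex {φ : Formula σ} (x : Fin 2) (h : IsGC2 φ) (hx : φ.free ⊆ {x}) : IsGC2 (exGe 1 x φ)
  | exGuarded {γ φ : Formula σ} (n : ℕ) (x : Fin 2) (hγ : IsGuard γ) (h : IsGC2 φ) :
      IsGC2 (exGe n x (and γ φ))

/-- Sentences of the guarded fragment. -/
def IsGC2Sentence (φ : Formula σ) : Prop := φ.IsGC2 ∧ φ.free = ∅

end Formula

/-- `J` satisfies every sentence of `Θ`. -/
def Models {σ : Signature.{u}} {A : Type v} (J : Interp σ A) (Θ : Set (Formula σ)) : Prop :=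
  ∀ θ ∈ Θ, ∀ e : Fin 2 → A, θ.Sat J e

/-! ## Gaifman graph, cycle-freeness, neighborhoods -/

/-- The Gaifman graph: its edges are the guarded pairs, that is, the pairs of distinct elements
that co-occur in some tuple. -/
def Interp.gaifman {σ : Signature.{u}} {A : Type v} (J : Interp σ A) : SimpleGraph A where
  Adj a b := a ≠ b ∧ ∃ R, J.bin R a b ∨ J.bin R b a
  symm := ⟨fun _ _ h => ⟨h.1.symm, h.2.imp fun _ => Or.symm⟩⟩
  loopless := ⟨fun _ h => h.1 rfl⟩

/-- Every (simple) cycle of the Gaifman graph only visits elements of `S`. -/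
def Interp.CycleFreeExcept {σ : Signature.{u}} {A : Type v} (J : Interp σ A) (S : Set A) : Prop :=
  ∀ (a : A) (p : J.gaifman.Walk a a), p.IsCycle → ∀ b ∈ p.support, b ∈ S

/-- Homomorphisms of interpretations. -/
def IsHom {σ : Signature.{u}} {A : Type v} {B : Type w} (T : Interp σ B) (J : Interp σ A)
    (π : B → A) : Prop :=
  (∀ P a, T.un P a → J.un P (π a)) ∧ ∀ R a b, T.bin R a b → J.bin R (π a) (π b)

/-! ## Bags -/

/-- An interpretation whose domain is a subset of `A`. -/
structure Bag (σ : Signature.{u}) (A : Type v) extends Interp σ A where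
  dom : Set A
  un_dom : ∀ P a, un P a → a ∈ dom
  bin_dom : ∀ R a b, bin R a b → a ∈ dom ∧ b ∈ dom

/-- The interpretation induced by `J` on the set `S`. -/
def Interp.induced {σ : Signature.{u}} {A : Type v} (J : Interp σ A) (S : Set A) : Bag σ A where
  un P a := J.un P a ∧ a ∈ S
  bin R a b := J.bin R a b ∧ a ∈ S ∧ b ∈ S
  dom := S
  un_dom _ _ h := h.2
  bin_dom _ _ _ h := h.2

/-- The restriction of `π` to the domain of `b` is an isomorphism from `b` to `c`. -/
def IsBagIso {σ : Signature.{u}} {A : Type v} {B : Type w} (π : B → A) (b : Bag σ B)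
    (c : Bag σ A) : Prop :=
  Set.BijOn π b.dom c.dom ∧
  (∀ P, ∀ x ∈ b.dom, (b.un P x ↔ c.un P (π x))) ∧
  ∀ R, ∀ x ∈ b.dom, ∀ y ∈ b.dom, (b.bin R x y ↔ c.bin R (π x) (π y))

/-- `c` is one of the bags of `J`, the interpretations induced by the guarded pairs of `J`. -/
def Interp.IsPairBag {σ : Signature.{u}} {A : Type v} (J : Interp σ A) (c : Bag σ A) : Prop :=
  ∃ a b, J.gaifman.Adj a b ∧ c = J.induced {a, b}

/-- The bags of `J` together with one additional bag, the fact bag, written `none`. (The fact bag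
is kept apart even if it has the same domain as another bag.) -/
abbrev Interp.BagOrFact {σ : Signature.{u}} {A : Type v} (J : Interp σ A) :=
  Option {c : Bag σ A // J.IsPairBag c}

/-- The interpretation carried by a bag, when the witness has domain `S`. -/
def Interp.BagOrFact.toBag {σ : Signature.{u}} {A : Type v} {J : Interp σ A} (S : Set A) :
    J.BagOrFact → Bag σ A
  | none => J.induced S
  | some c => c.1

/-! ## Tree-like interpretations -/

/-- A rooted directed tree of bags. -/
structure BagTree (σ : Signature.{u}) (B : Type v) where
  Node : Type v
  root : Node
  /-- `E b b'` : the node `b'` is a child of `b` -/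
  E : Node → Node → Prop
  bag : Node → Bag σ B
  root_no_parent : ∀ b, ¬ E b root
  unique_parent : ∀ b, b ≠ root → ∃! p, E p b
  reachable : ∀ b, Relation.ReflTransGen E root b

namespace BagTree

variable {σ : Signature.{u}} {B : Type v}

/-- The element `a` is introduced in `b`: it occurs in `b`, and otherwise only in children
of `b`. -/
def Introduced (T : BagTree σ B) (b : T.Node) (a : B) : Prop :=
  a ∈ (T.bag b).dom ∧ ∀ b', a ∈ (T.bag b').dom → b' = b ∨ T.E b b'

/-- The tree of bags is a tree-like interpretation with domain `B`: every element is introduced in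
some bag (so bags sharing an element are siblings, or parent and child), a bag shares exactly one
element with each child, that element is introduced in it, and if the bag is not the root then
the shared element is the same for all children. -/
structure IsTreeLike (T : BagTree σ B) : Prop where
  exists_introduced : ∀ a, ∃ b, T.Introduced b a
  shares_one : ∀ b b', T.E b b' → ∃! a, a ∈ (T.bag b).dom ∧ a ∈ (T.bag b').dom
  shared_introduced : ∀ b b', T.E b b' → ∀ a, a ∈ (T.bag b).dom → a ∈ (T.bag b').dom →
    T.Introduced b a
  shared_by_children : ∀ b, b ≠ T.root → ∀ b' b'', T.E b b' → T.E b b'' →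
    ∀ a, a ∈ (T.bag b).dom → a ∈ (T.bag b').dom → a ∈ (T.bag b'').dom

/-- The tree seen as an interpretation: the union of its bags. -/
def toInterp (T : BagTree σ B) : Interp σ B where
  un P a := ∃ b, (T.bag b).un P a
  bin R a a' := ∃ b, (T.bag b).bin R a a'

/-- `T` is an unraveling of `J` preserving the witness with domain `S`: it is tree-like, its root
bag is the fact bag (the interpretation induced by `J` on `S`), where the element `s` of `S`
is called `ι s` in `T`, and all its other bags have two elements. The elements of `T` other than
the `ι s` are fresh. -/
structure IsUnraveling {A : Type w} (T : BagTree σ B) (J : Interp σ A) (S : Set A)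
    (ι : S → B) : Prop where
  treeLike : T.IsTreeLike
  ι_injective : Function.Injective ι
  root_dom : (T.bag T.root).dom = Set.range ι
  root_un : ∀ P s, (T.bag T.root).un P (ι s) ↔ J.un P s
  root_bin : ∀ R s t, (T.bag T.root).bin R (ι s) (ι t) ↔ J.bin R s t
  card_dom : ∀ b, b ≠ T.root → (T.bag b).dom.ncard = 2

/-- `T` is a faithful unraveling of `J` preserving the witness with domain `S`, through the
homomorphism `π` to `J` and the map `φ` to the bags of `J`. -/
structure IsFaithfulVia {A : Type w} (T : BagTree σ B) (J : Interp σ A) (S : Set A)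
    (ι : S → B) (π : B → A) (φ : T.Node → J.BagOrFact) : Prop where
  unraveling : T.IsUnraveling J S ι
  hom : IsHom T.toInterp J π
  /-- the root, and no other node, is mapped to the fact bag -/
  fact_iff : ∀ b, φ b = none ↔ b = T.root
  /-- `π` restricts to an isomorphism from each bag to its image ... -/
  compat : ∀ b, IsBagIso π (T.bag b) ((φ b).toBag S)
  /-- ... and is the identity on the root bag -/
  compat_root : ∀ s, π (ι s) = s
  /-- `π` restricts to a bijection from the immediate neighbors of `a` to those of `π a` ... -/
  nbhd : ∀ a, Set.BijOn π (T.toInterp.gaifman.neighborSet a) (J.gaifman.neighborSet (π a))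
  /-- ... that preserves and reflects all tuples on `a` and a neighbor -/
  nbhd_iso : ∀ a, ∀ a' ∈ T.toInterp.gaifman.neighborSet a,
    IsBagIso π (T.toInterp.induced {a, a'}) (J.induced {π a, π a'})
  /-- every bag of `J` that is not inside `S` is the image of a node -/
  surj : ∀ c : {c : Bag σ A // J.IsPairBag c}, ¬ c.1.dom ⊆ S → ∃ b, φ b = some c

/-- `T` is a faithful unraveling of `J` preserving the witness with domain `S`. -/
def IsFaithfulUnraveling {A : Type w} (T : BagTree σ B) (J : Interp σ A) (S : Set A)
    (ι : S → B) : Prop :=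
  ∃ (π : B → A) (φ : T.Node → J.BagOrFact), T.IsFaithfulVia J S ι π φ

end BagTree

end GuardedUnraveling

open GuardedUnraveling

universe u v

namespace GuardedUnraveling

open Function

universe w

/-! ## The interpretation of non-backtracking paths -/

section Paths

variable {σ : Signature.{u}} {A : Type v}

/-! The unraveling consists of the non-backtracking paths that start in the witness domain `S` and
leave it with their first step, each labelled like its end. A path may end in `S` again later; it is
then a fresh copy. The map `Interp.Path.last` is locally bijective: the paths sharing a bag with `x`
are `x`, its prolongations, the path it prolongs and, if `x` has length one, all paths of length
one. Their ends cover all neighbors of the end of `x` (`Interp.Path.exists_cobag`) and are distinct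
(`Interp.Path.cobag_unique`), which is what the restrictions on prolongations are made for. Guarded
counting sees only such neighborhoods, and plain quantification only one element at a time, so truth
of guarded sentences transfers (`Formula.IsGC2.sat_iff`). A match of `q` would be mapped to `J` by
the homomorphism. A path of length above one has at most one neighbor that is not longer, so cycles
stay in the root bag (`rank_eq_zero_of_isCycle`). Paths end only in elements connected with `S`,
whereas plain quantifiers and faithfulness require every element to be reached. The fresh relation
ensures this by joining one element of `S` to everything; dropping it afterwards only deletes edges.
-/

/-- The elements by which a path of `J` can be extended. Paths are lists whose head is their last
element; they start in `S`, leave `S` with their first step, and never turn back. -/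
def Interp.extensions (J : Interp σ A) (S : Set A) : List A → Set A
  | [] => S
  | [b] => {a | J.gaifman.Adj b a ∧ a ∉ S}
  | b :: c :: _ => {a | J.gaifman.Adj b a ∧ a ≠ c}

/-- Non-backtracking paths that start in `S` and leave `S` with their first step. -/
inductive Interp.IsPath (J : Interp σ A) (S : Set A) : List A → Prop
  | nil : IsPath J S []
  | cons {a : A} {l : List A} (h : IsPath J S l) (ha : a ∈ J.extensions S l) : IsPath J S (a :: l)

theorem Interp.isPath_cons {J : Interp σ A} {S : Set A} {a : A} {l : List A} :
    J.IsPath S (a :: l) ↔ J.IsPath S l ∧ a ∈ J.extensions S l :=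
  ⟨fun h => by cases h; constructor <;> assumption, fun h => .cons h.1 h.2⟩

theorem Interp.isPath_singleton {J : Interp σ A} {S : Set A} {a : A} :
    J.IsPath S [a] ↔ a ∈ S := by
  simp [isPath_cons, Interp.IsPath.nil, Interp.extensions]

theorem Interp.isPath_pair {J : Interp σ A} {S : Set A} {a b : A} :
    J.IsPath S [a, b] ↔ b ∈ S ∧ J.gaifman.Adj b a ∧ a ∉ S := by
  rw [isPath_cons, isPath_singleton]; rfl

theorem Interp.isPath_cons_cons_cons {J : Interp σ A} {S : Set A} {a b c : A} {l : List A} :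
    J.IsPath S (a :: b :: c :: l) ↔
      J.IsPath S (b :: c :: l) ∧ J.gaifman.Adj b a ∧ a ≠ c := isPath_cons

theorem Interp.IsPath.tail {J : Interp σ A} {S : Set A} {l : List A} (h : J.IsPath S l) :
    J.IsPath S l.tail := by
  cases h with
  | nil => exact .nil
  | cons h _ => exact h

theorem Interp.IsPath.adj {J : Interp σ A} {S : Set A} {a b : A} {l : List A}
    (h : J.IsPath S (a :: b :: l)) : J.gaifman.Adj b a := by
  cases l with
  | nil => exact (isPath_pair.1 h).2.1
  | cons c l => exact (isPath_cons_cons_cons.1 h).2.1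

/-- The elements of the unraveling: the non-empty paths. -/
def Interp.Path (J : Interp σ A) (S : Set A) : Type v := {l : List A // J.IsPath S l ∧ l ≠ []}

/-- The element in which a path ends. -/
def Interp.Path.last {J : Interp σ A} {S : Set A} (x : J.Path S) : A := x.1.head x.2.2

/-- The path that consists of an element of `S`. -/
def Interp.Path.base (J : Interp σ A) (S : Set A) (s : S) : J.Path S :=
  ⟨[s.1], isPath_singleton.2 s.2, List.cons_ne_nil _ _⟩

/-- The nodes of the unraveling: the root `[]`, and the paths that are not in the root bag. -/
def Interp.PathNode (J : Interp σ A) (S : Set A) : Type v :=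
  {l : List A // J.IsPath S l ∧ l.length ≠ 1}

/-- The domain of a node: the paths of length one for the root, and a path together with the path
that it prolongs for the other nodes. -/
def Interp.PathNode.dom {J : Interp σ A} {S : Set A} (b : J.PathNode S) : Set (J.Path S) :=
  {x | x.1 = b.1 ∨ x.1 = b.1.tail ∨ b.1 = [] ∧ x.1.length = 1}

/-- The child relation between nodes. -/
def Interp.PathNode.Child {J : Interp σ A} {S : Set A} (b b' : J.PathNode S) : Prop :=
  b'.1 ≠ [] ∧ (b'.1.tail = b.1 ∨ b.1 = [] ∧ b'.1.length = 2)

/-- Every path is labelled like the element in which it ends. -/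
def Interp.pathInterp (J : Interp σ A) (S : Set A) : Interp σ (J.Path S) where
  un P x := J.un P x.last
  bin R x y := J.bin R x.last y.last

/-- The root node. -/
def Interp.PathNode.root (J : Interp σ A) (S : Set A) : J.PathNode S := ⟨[], .nil, by simp⟩

/-- A path of length two prolongs a path of length one, which is not a node, so its parent is the
root; any longer path has its tail as parent. The drop in length drives the induction for
reachability. -/
theorem Interp.PathNode.exists_child {J : Interp σ A} {S : Set A} (b : J.PathNode S)
    (hb : b.1 ≠ []) : ∃ p : J.PathNode S, p.Child b ∧ p.1.length < b.1.length := by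
  obtain ⟨l, hl, hl1⟩ := b
  match l, hl, hl1, hb with
  | [a, b], hl, hl1, _ => exact ⟨root J S, by simp [Child, root], by simp [root]⟩
  | a :: b :: c :: l, hl, hl1, _ =>
    exact ⟨⟨b :: c :: l, hl.tail, by simp⟩, by simp [Child], by simp⟩

theorem Interp.PathNode.tail_ne_nil {J : Interp σ A} {S : Set A} {b : J.PathNode S}
    (hb : b.1 ≠ []) : b.1.tail ≠ [] := by
  obtain ⟨l, hl, hl1⟩ := b
  match l, hl, hl1, hb with
  | a :: c :: l, _, _, _ => exact List.cons_ne_nil _ _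

/-- The unraveling of `J` into a tree of bags. -/
def Interp.pathTree (J : Interp σ A) (S : Set A) : BagTree σ (J.Path S) where
  Node := J.PathNode S
  root := PathNode.root J S
  E := PathNode.Child
  bag b := (J.pathInterp S).induced b.dom
  root_no_parent _ h := h.1 rfl
  unique_parent b hb := by
    obtain ⟨p, hp, -⟩ := b.exists_child fun h => hb (Subtype.ext h)
    refine ⟨p, hp, fun p' hp' => Subtype.ext ?_⟩
    have h1 := p.2.2
    have h2 := p'.2.2
    unfold PathNode.Child at hp hp'
    grind
  reachable b := by
    induction h : b.1.length using Nat.strong_induction_on generalizing b with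
    | _ n ih =>
      by_cases hb : b.1 = []
      · rw [show b = PathNode.root J S from Subtype.ext hb]
      · obtain ⟨p, hp, hlt⟩ := b.exists_child hb
        exact (ih _ (h ▸ hlt) p rfl).tail hp

/-! ### Tree-likeness of the tree of paths -/

variable {J : Interp σ A} {S : Set A}

theorem Interp.Path.exists_introduced (x : J.Path S) :
    ∃ b : J.PathNode S, (J.pathTree S).Introduced b x := by
  obtain ⟨l, hl, hl0⟩ := x
  by_cases h1 : l.length = 1
  · refine ⟨PathNode.root J S, .inr (.inr ⟨rfl, h1⟩), ?_⟩
    rintro ⟨l', hl', hl1'⟩ (h | h | h)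
    · grind
    · exact .inr ⟨by simp; grind, by simp [PathNode.root]; grind⟩
    · exact .inl (Subtype.ext h.1)
  · refine ⟨⟨l, hl, h1⟩, .inl rfl, ?_⟩
    rintro ⟨l', hl', hl1'⟩ (h | h | h)
    · exact .inl (Subtype.ext h.symm)
    · exact .inr ⟨by simp; grind, by simp; grind⟩
    · grind

theorem Interp.mem_dom_pathTree {b : J.PathNode S} {x : J.Path S} :
    x ∈ ((J.pathTree S).bag b).dom ↔
      x.1 = b.1 ∨ x.1 = b.1.tail ∨ b.1 = [] ∧ x.1.length = 1 := Iff.rfl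

theorem Interp.pathTree_E {b b' : J.PathNode S} :
    (J.pathTree S).E b b' ↔
      b'.1 ≠ [] ∧ (b'.1.tail = b.1 ∨ b.1 = [] ∧ b'.1.length = 2) := Iff.rfl

/-- The conditions on shared elements all follow from this description. It covers the children of
the root too: they have length two, so their tails are one-element paths and lie in the root bag. -/
theorem Interp.shared_iff {b b' : J.PathNode S} (h : (J.pathTree S).E b b') {x : J.Path S} :
    x ∈ ((J.pathTree S).bag b).dom ∧ x ∈ ((J.pathTree S).bag b').dom ↔ x.1 = b'.1.tail := by
  rw [pathTree_E] at h
  rw [mem_dom_pathTree, mem_dom_pathTree]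
  have h0 := List.length_pos_iff.2 x.2.2
  have h1 := b.2.2
  have h2 := b'.2.2
  have h3 := List.length_pos_iff.2 h.1
  grind

theorem Interp.pathTree_isTreeLike : (J.pathTree S).IsTreeLike where
  exists_introduced := Path.exists_introduced
  shares_one b b' h := by
    have h2 : b'.1.tail ≠ [] := PathNode.tail_ne_nil h.1
    refine ⟨⟨b'.1.tail, b'.2.1.tail, h2⟩, (shared_iff h).2 rfl, fun y hy => ?_⟩
    exact Subtype.ext ((shared_iff h).1 hy)
  shared_introduced b b' h x hx hx' := by
    refine ⟨hx, fun b'' hx'' => ?_⟩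
    have hs := (shared_iff h).1 ⟨hx, hx'⟩
    have hd := mem_dom_pathTree.1 hx''
    have hE := pathTree_E.1 h
    have h0 := List.length_pos_iff.2 x.2.2
    have h4 := List.length_pos_iff.2 hE.1
    have h1 := b.2.2
    have h2 := b'.2.2
    have h3 := b''.2.2
    have : b''.1 = b.1 ∨ b''.1 ≠ [] ∧ (b''.1.tail = b.1 ∨ b.1 = [] ∧ b''.1.length = 2) := by
      grind
    exact this.imp_left fun h => Subtype.ext h
  shared_by_children b hb b' b'' h' h'' x hx hx' := by
    have hs := (shared_iff h').1 ⟨hx, hx'⟩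
    refine ((shared_iff h'').2 ?_).2
    -- Away from the root, every child has the path `b` itself as its tail. Only children of the
    -- root can share different elements.
    have hb : b.1 ≠ [] := fun h => hb (Subtype.ext h)
    have h1 := (pathTree_E.1 h').2
    have h2 := (pathTree_E.1 h'').2
    grind

/-! ### Paths in a common bag, and the Gaifman graph of the tree -/

theorem Interp.Path.length_pos (x : J.Path S) : 0 < x.1.length := List.length_pos_iff.2 x.2.2

theorem Interp.Path.exists_eq_cons (x : J.Path S) : ∃ l, x.1 = x.last :: l := by
  obtain ⟨l, hl, h0⟩ := x
  cases l with
  | nil => exact absurd rfl h0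
  | cons a l => exact ⟨l, rfl⟩

/-- Two paths lie in a common bag. -/
def Interp.Path.Cobag (x y : J.Path S) : Prop := ∃ b : J.PathNode S, x ∈ b.dom ∧ y ∈ b.dom

theorem Interp.Path.cobag_iff {x y : J.Path S} :
    x.Cobag y ↔ x = y ∨ x.1 = y.1.tail ∨ y.1 = x.1.tail ∨ x.1.length = 1 ∧ y.1.length = 1 := by
  have hx := x.2.2
  have hy := y.2.2
  constructor
  · rintro ⟨b, h1, h2⟩
    unfold PathNode.dom at h1 h2
    have : x.1 = y.1 ∨ x.1 = y.1.tail ∨ y.1 = x.1.tail ∨ x.1.length = 1 ∧ y.1.length = 1 := by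
      grind
    exact this.imp_left fun h => Subtype.ext h
  · have key : ∀ z w : J.Path S, z.1 = w.1.tail → z.Cobag w := fun z w h => by
      have hz := z.2.2
      -- The common bag is that of the node `w`: if `w` had length one, its tail `z` would be empty.
      refine ⟨⟨w.1, w.2.1, fun h1 => hz ?_⟩, .inr (.inl h), .inl rfl⟩
      obtain ⟨a, ha⟩ := List.length_eq_one_iff.1 h1
      rw [h, ha, List.tail_cons]
    rintro (rfl | h | h | h)
    · obtain ⟨b, hb⟩ := x.exists_introduced
      exact ⟨b, hb.1, hb.1⟩
    · exact key _ _ h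
    · obtain ⟨b, h1, h2⟩ := key _ _ h
      exact ⟨b, h2, h1⟩
    · exact ⟨PathNode.root J S, .inr (.inr ⟨rfl, h.1⟩), .inr (.inr ⟨rfl, h.2⟩)⟩

theorem Interp.pathTree_un {P : σ.Un} {x : J.Path S} :
    (J.pathTree S).toInterp.un P x ↔ J.un P x.last := by
  obtain ⟨b, hb⟩ := x.exists_introduced
  exact ⟨fun ⟨_, h⟩ => h.1, fun h => ⟨b, h, hb.1⟩⟩

theorem Interp.pathTree_bin {R : σ.Bin} {x y : J.Path S} :
    (J.pathTree S).toInterp.bin R x y ↔ J.bin R x.last y.last ∧ x.Cobag y :=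
  ⟨fun ⟨b, h⟩ => ⟨h.1, b, h.2⟩, fun ⟨h, b, hb⟩ => ⟨b, h, hb⟩⟩

theorem Interp.Path.adj_last_of_tail {x y : J.Path S} (h : x.1 = y.1.tail) :
    J.gaifman.Adj x.last y.last := by
  obtain ⟨l, hl⟩ := x.exists_eq_cons
  obtain ⟨l', hl'⟩ := y.exists_eq_cons
  have := y.2.1
  rw [hl'] at this h
  rw [List.tail_cons, hl] at h
  rw [← h] at this
  exact this.adj

/-- A path and its prolongation end in adjacent, hence distinct, elements, and a path of length one
is determined by its end. -/
theorem Interp.Path.last_injOn_cobag {x y : J.Path S} (h : x.Cobag y) (he : x.last = y.last) :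
    x = y := by
  rcases cobag_iff.1 h with h | h | h | ⟨h1, h2⟩
  · exact h
  · exact absurd he (adj_last_of_tail h).ne
  · exact absurd he (adj_last_of_tail h).ne'
  · obtain ⟨l, hl⟩ := x.exists_eq_cons
    obtain ⟨l', hl'⟩ := y.exists_eq_cons
    refine Subtype.ext ?_
    rw [hl] at h1
    rw [hl'] at h2
    rw [hl, hl', he]
    simp_all

theorem Interp.pathTree_adj {x y : J.Path S} :
    (J.pathTree S).toInterp.gaifman.Adj x y ↔ J.gaifman.Adj x.last y.last ∧ x.Cobag y := by
  have hsymm : y.Cobag x ↔ x.Cobag y := exists_congr fun _ => and_comm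
  constructor
  · rintro ⟨hne, R, h⟩
    rw [pathTree_bin, pathTree_bin, hsymm] at h
    have hc : x.Cobag y := h.elim And.right And.right
    exact ⟨⟨fun he => hne (Path.last_injOn_cobag hc he), R, h.imp And.left And.left⟩, hc⟩
  · rintro ⟨⟨hne, R, h⟩, hc⟩
    refine ⟨fun he => hne (he ▸ rfl), R, ?_⟩
    rw [pathTree_bin, pathTree_bin, hsymm]
    exact h.imp (⟨·, hc⟩) (⟨·, hc⟩)

/-- Every neighbor of the end of a path is the end of a path in a common bag. -/
theorem Interp.Path.exists_cobag (x : J.Path S) {a : A} (h : J.gaifman.Adj x.last a) :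
    ∃ y : J.Path S, y.last = a ∧ x.Cobag y := by
  obtain ⟨l, hl, h0⟩ := x
  match l, hl, h0, h with
  | [b], hl, h0, h =>
    -- A neighbor in `S` is already present in the root bag; the others are reached by leaving `S`.
    by_cases ha : a ∈ S
    · exact ⟨base J S ⟨a, ha⟩, rfl, cobag_iff.2 (.inr (.inr (.inr ⟨rfl, rfl⟩)))⟩
    · exact ⟨⟨[a, b], isPath_pair.2 ⟨isPath_singleton.1 hl, h, ha⟩, by simp⟩, rfl,
        cobag_iff.2 (.inr (.inl rfl))⟩
  | b :: c :: l, hl, h0, h =>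
    -- Turning back to `c` is realized by the shorter path.
    by_cases ha : a = c
    · exact ⟨⟨c :: l, hl.tail, by simp⟩, ha.symm, cobag_iff.2 (.inr (.inr (.inl rfl)))⟩
    · exact ⟨⟨a :: b :: c :: l, isPath_cons_cons_cons.2 ⟨hl, h, ha⟩, by simp⟩, rfl,
        cobag_iff.2 (.inr (.inl rfl))⟩

/-- Paths that share a bag with `x` and end in the same element are equal. -/
theorem Interp.Path.cobag_unique {x y z : J.Path S} (hy : x.Cobag y) (hz : x.Cobag z)
    (h : y.last = z.last) : y = z := by
  by_cases hxy : x = y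
  · exact last_injOn_cobag (hxy ▸ hz) h
  by_cases hxz : x = z
  · exact (last_injOn_cobag (hxz ▸ hy) h.symm).symm
  rw [cobag_iff] at hy hz
  obtain ⟨k, hk⟩ := x.exists_eq_cons
  obtain ⟨l, hl⟩ := y.exists_eq_cons
  obtain ⟨m, hm⟩ := z.exists_eq_cons
  have hyp := y.2.1
  have hzp := z.2.1
  have hxp := x.2.1
  refine Subtype.ext ?_
  replace hy := hy.resolve_left hxy
  replace hz := hz.resolve_left hxz
  rw [hk] at hy hz hxp
  rw [hl, h] at hy hyp
  rw [hm] at hz hzp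
  rw [hl, hm, h]
  generalize x.last = a at *
  generalize z.last = b at *
  cases k with
  | nil =>
    -- From a path of length one, root elements end inside `S` and prolongations outside, so the two
    -- kinds cannot have the same end.
    have e1 : J.IsPath S [b] → J.IsPath S [b, a] → False := fun h1 h2 =>
      (isPath_pair.1 h2).2.2 (isPath_singleton.1 h1)
    simp only [List.tail_cons, List.length_cons] at hy hz
    grind
  | cons c k =>
    -- No prolongation ends where the shorter path does, because paths do not turn back.
    have e1 : ∀ l, J.IsPath S (c :: a :: c :: l) → False := fun l h1 =>
      (isPath_cons_cons_cons.1 h1).2.2 rfl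
    simp only [List.tail_cons, List.length_cons] at hy hz
    grind

theorem Interp.pathTree_bijOn (x : J.Path S) :
    Set.BijOn Path.last ((J.pathTree S).toInterp.gaifman.neighborSet x)
      (J.gaifman.neighborSet x.last) := by
  refine ⟨fun y hy => (pathTree_adj.1 hy).1, fun y hy z hz h => ?_, fun a ha => ?_⟩
  · exact Path.cobag_unique (pathTree_adj.1 hy).2 (pathTree_adj.1 hz).2 h
  · obtain ⟨y, rfl, hc⟩ := x.exists_cobag ha
    exact ⟨y, pathTree_adj.2 ⟨ha, hc⟩, rfl⟩

/-- A walk from `S` lifts edge by edge along common bags. The walk may backtrack or stay in `S`; its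
lift then returns to a shorter path or moves within the root bag. -/
theorem Interp.Path.exists_last_eq (hS : ∀ a, ∃ s ∈ S, J.gaifman.Reachable s a) (a : A) :
    ∃ x : J.Path S, x.last = a := by
  obtain ⟨s, hs, ⟨p⟩⟩ := hS a
  suffices ∀ {b c : A} (_ : J.gaifman.Walk b c), (∃ x : J.Path S, x.last = b) →
      ∃ x : J.Path S, x.last = c from this p ⟨base J S ⟨s, hs⟩, rfl⟩
  intro b c p
  induction p with
  | nil => exact id
  | cons h _ ih =>
    rintro ⟨x, rfl⟩
    obtain ⟨y, hy, -⟩ := x.exists_cobag h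
    exact ih ⟨y, hy⟩

/-! ### Faithfulness -/

theorem Interp.Path.mem_root_iff {x : J.Path S} :
    x ∈ (PathNode.root J S).dom ↔ x ∈ Set.range (base J S) := by
  have h0 := x.2.2
  have hp := x.2.1
  constructor
  · rintro (h | h | ⟨-, h⟩)
    · exact absurd h h0
    · exact absurd h h0
    · obtain ⟨a, ha⟩ := List.length_eq_one_iff.1 h
      rw [ha] at hp
      exact ⟨⟨a, isPath_singleton.1 hp⟩, Subtype.ext ha.symm⟩
  · rintro ⟨s, rfl⟩
    exact .inr (.inr ⟨rfl, rfl⟩)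

/-- A node other than the root consists of a path and the path that it prolongs. -/
theorem Interp.PathNode.exists_dom_eq (b : J.PathNode S) (hb : b ≠ root J S) :
    ∃ x y : J.Path S, x.1 = y.1.tail ∧ b.dom = {x, y} := by
  have hb : b.1 ≠ [] := fun h => hb (Subtype.ext h)
  refine ⟨⟨b.1.tail, b.2.1.tail, tail_ne_nil hb⟩, ⟨b.1, b.2.1, hb⟩, rfl, ?_⟩
  ext z
  have h : z ∈ b.dom ↔ z.1 = b.1 ∨ z.1 = b.1.tail :=
    or_congr_right (or_iff_left fun h => hb h.1)
  rw [h, or_comm]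
  exact or_congr ⟨fun h => Subtype.ext h, fun h => congrArg Subtype.val h⟩
    ⟨fun h => Subtype.ext h, fun h => congrArg Subtype.val h⟩

theorem Interp.PathNode.image_dom_root : Path.last '' (root J S).dom = S := by
  rw [Set.ext fun _ => Path.mem_root_iff, ← Set.range_comp]
  exact Subtype.range_coe

theorem Interp.PathNode.injOn_dom (b : J.PathNode S) : Set.InjOn Path.last b.dom :=
  fun _ hx _ hy h => Path.last_injOn_cobag ⟨b, hx, hy⟩ h

theorem isBagIso_induced {B : Type w} {K : Interp σ B} {J : Interp σ A} {π : B → A} {D : Set B}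
    (hinj : Set.InjOn π D) (hun : ∀ P, ∀ x ∈ D, (K.un P x ↔ J.un P (π x)))
    (hbin : ∀ R, ∀ x ∈ D, ∀ y ∈ D, (K.bin R x y ↔ J.bin R (π x) (π y))) :
    IsBagIso π (K.induced D) (J.induced (π '' D)) :=
  ⟨hinj.bijOn_image,
    fun P x hx => and_congr (hun P x hx) (iff_of_true hx (Set.mem_image_of_mem π hx)),
    fun R x hx y hy => and_congr (hbin R x hx y hy) (and_congr
      (iff_of_true hx (Set.mem_image_of_mem π hx)) (iff_of_true hy (Set.mem_image_of_mem π hy)))⟩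

theorem Interp.PathNode.isPairBag (b : J.PathNode S) (hb : b ≠ root J S) :
    J.IsPairBag (J.induced (Path.last '' b.dom)) := by
  obtain ⟨x, y, h, hd⟩ := b.exists_dom_eq hb
  exact ⟨x.last, y.last, Path.adj_last_of_tail h, by rw [hd, Set.image_pair]⟩

open Classical in
/-- The bag of `J` of which a node is a copy. -/
noncomputable def Interp.PathNode.toBagOrFact (b : J.PathNode S) : J.BagOrFact :=
  if hb : b = root J S then none else some ⟨_, b.isPairBag hb⟩

theorem Interp.PathNode.toBag_toBagOrFact (b : J.PathNode S) :
    b.toBagOrFact.toBag S = J.induced (Path.last '' b.dom) := by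
  unfold toBagOrFact
  split_ifs with hb
  · rw [hb, image_dom_root]
    rfl
  · rfl

theorem Interp.pathTree_isUnraveling : (J.pathTree S).IsUnraveling J S (Path.base J S) where
  treeLike := pathTree_isTreeLike
  ι_injective _ _ h := Subtype.ext (congrArg Path.last h)
  root_dom := Set.ext fun _ => Path.mem_root_iff
  root_un _ s := and_iff_left (Path.mem_root_iff.2 ⟨s, rfl⟩)
  root_bin _ s t := and_iff_left ⟨Path.mem_root_iff.2 ⟨s, rfl⟩, Path.mem_root_iff.2 ⟨t, rfl⟩⟩
  card_dom b hb := by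
    obtain ⟨x, y, h, hd⟩ := PathNode.exists_dom_eq b hb
    refine (congrArg Set.ncard hd).trans (Set.ncard_pair ?_)
    exact fun he => (Path.adj_last_of_tail h).ne (congrArg Path.last he)

/-- If every element is connected with `S`, the tree of paths is a faithful unraveling. -/
theorem Interp.pathTree_isFaithfulVia (hS : ∀ a, ∃ s ∈ S, J.gaifman.Reachable s a) :
    (J.pathTree S).IsFaithfulVia J S (Path.base J S) Path.last PathNode.toBagOrFact where
  unraveling := pathTree_isUnraveling
  hom := ⟨fun _ _ => pathTree_un.1, fun _ _ _ h => (pathTree_bin.1 h).1⟩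
  fact_iff b := by
    unfold PathNode.toBagOrFact
    split_ifs with hb
    · exact iff_of_true rfl hb
    · exact iff_of_false (by simp) hb
  compat := fun (b : J.PathNode S) => by
    rw [PathNode.toBag_toBagOrFact]
    exact isBagIso_induced b.injOn_dom (fun _ _ _ => Iff.rfl) fun _ _ _ _ _ => Iff.rfl
  compat_root _ := rfl
  nbhd := pathTree_bijOn
  nbhd_iso x y hy := by
    obtain ⟨b, hx, hy⟩ := (pathTree_adj.1 hy).2
    have hsub : {x, y} ⊆ b.dom := Set.pair_subset hx hy
    rw [← Set.image_pair]
    exact isBagIso_induced (b.injOn_dom.mono hsub) (fun _ _ _ => pathTree_un)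
      fun _ _ hz _ hw => pathTree_bin.trans (and_iff_left ⟨b, hsub hz, hsub hw⟩)
  surj := by
    rintro ⟨_, a, a', h, rfl⟩ hdom
    obtain ⟨x, rfl⟩ := Path.exists_last_eq hS a
    obtain ⟨y, rfl, b, hx, hy⟩ := x.exists_cobag h
    -- The root bag projects onto `S`, which does not contain the given pair.
    have hb : b ≠ PathNode.root J S := by
      rintro rfl
      exact hdom ((Set.pair_subset (Set.mem_image_of_mem _ hx) (Set.mem_image_of_mem _ hy)).trans
        PathNode.image_dom_root.subset)
    have hd : b.dom = {x, y} := by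
      obtain ⟨z, w, -, hd⟩ := b.exists_dom_eq hb
      have hne : x ≠ y := fun he => h.ne (congrArg Path.last he)
      rw [hd] at hx hy ⊢
      grind
    refine ⟨b, ?_⟩
    rw [PathNode.toBagOrFact, dif_neg hb]
    simp only [hd, Set.image_pair]

end Paths

/-! ## Guarded formulas -/

section Formulas

variable {σ : Signature.{u}} {A : Type v} {B : Type w}

/-- Truth of a formula depends on its free variables only. -/
theorem Formula.sat_congr {J : Interp σ A} (φ : Formula σ) {e e' : Fin 2 → A}
    (h : ∀ x ∈ φ.free, e x = e' x) : φ.Sat J e ↔ φ.Sat J e' := by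
  induction φ generalizing e e' with
  | falsum => rfl
  | eq x y => simp only [Sat, h x (.inl rfl), h y (.inr rfl)]
  | un P x => simp only [Sat, h x rfl]
  | bin R x y => simp only [Sat, h x (.inl rfl), h y (.inr rfl)]
  | neg φ ih => exact not_congr (ih h)
  | and φ ψ ih₁ ih₂ =>
    exact and_congr (ih₁ fun x hx => h x (.inl hx)) (ih₂ fun x hx => h x (.inr hx))
  | exGe n x φ ih =>
    simp only [Sat]
    rw [Set.ext fun a => ih (e := update e x a) (e' := update e' x a) fun y hy => ?_]
    by_cases hyx : y = x
    · simp [hyx]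
    · simpa [hyx] using h y ⟨hy, hyx⟩

theorem Formula.sat_update {J : Interp σ A} {φ : Formula σ} {x : Fin 2} (hx : φ.free ⊆ {x})
    {e : Fin 2 → A} {a : A} : φ.Sat J (update e x a) ↔ φ.Sat J fun _ => a :=
  Formula.sat_congr φ fun y hy => by
    obtain rfl := hx hy
    exact update_self ..

/-- `π` is a surjection from `T` to `J` under which every `x`, together with the elements related to
it by `G`, is in bijection with a set that contains the neighbors of `π x`, such that `π` preserves
and reflects tuples on pairs in `G`, and all tuples of `T` are on such pairs. -/
structure IsGuardedCover (T : Interp σ B) (J : Interp σ A) (G : B → B → Prop) (π : B → A) :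
    Prop where
  refl : ∀ x, G x x
  symm : ∀ x y, G x y → G y x
  surj : Surjective π
  inj : ∀ x y z, G x y → G x z → π y = π z → y = z
  lift : ∀ x a, a = π x ∨ J.gaifman.Adj (π x) a → ∃ y, π y = a ∧ G x y
  un : ∀ P x, T.un P x ↔ J.un P (π x)
  bin : ∀ R x y, T.bin R x y ↔ J.bin R (π x) (π y) ∧ G x y

theorem Formula.IsGuard.of_sat {γ : Formula σ} (hγ : γ.IsGuard) {J : Interp σ A} {e : Fin 2 → A}
    (h : γ.Sat J e) {x y : Fin 2} (hxy : x ≠ y) : e y = e x ∨ J.gaifman.Adj (e x) (e y) := by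
  cases hγ with
  | @eq z w hzw =>
    have h : e z = e w := h
    have : z = x ∧ w = y ∨ z = y ∧ w = x := by omega
    rcases this with ⟨rfl, rfl⟩ | ⟨rfl, rfl⟩
    · exact .inl h.symm
    · exact .inl h
  | @bin R z w hzw =>
    refine or_iff_not_imp_left.2 fun hne => ⟨Ne.symm hne, R, ?_⟩
    have : z = x ∧ w = y ∨ z = y ∧ w = x := by omega
    rcases this with ⟨rfl, rfl⟩ | ⟨rfl, rfl⟩
    · exact .inl h
    · exact .inr h

theorem IsGuardedCover.of_adj {T : Interp σ B} {J : Interp σ A} {G : B → B → Prop} {π : B → A}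
    (c : IsGuardedCover T J G π) {x y : B} (h : y = x ∨ T.gaifman.Adj x y) : G x y := by
  rcases h with rfl | ⟨-, R, h | h⟩
  · exact c.refl y
  · exact ((c.bin _ _ _).1 h).2
  · exact c.symm _ _ ((c.bin _ _ _).1 h).2

/-- Induction on the formula, with the invariant that the two values are related by `G`. This makes
equality atoms reflect along `π`, and the guard restores it under counting quantifiers. -/
theorem Formula.IsGC2.sat_iff {T : Interp σ B} {J : Interp σ A} {G : B → B → Prop} {π : B → A}
    (c : IsGuardedCover T J G π) {φ : Formula σ} (hφ : φ.IsGC2) {e : Fin 2 → B}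
    (he : G (e 0) (e 1)) : φ.Sat T e ↔ φ.Sat J (π ∘ e) := by
  have hG : ∀ {e : Fin 2 → B}, G (e 0) (e 1) → ∀ x y, G (e x) (e y) := by
    intro e he x y
    fin_cases x <;> fin_cases y
    exacts [c.refl _, he, c.symm _ _ he, c.refl _]
  have hcomp : ∀ (e : Fin 2 → B) x a, π ∘ update e x a = update (π ∘ e) x (π a) :=
    fun e x a => comp_update π e x a
  have hatom : ∀ {γ : Formula σ}, γ.IsGuard → ∀ {e : Fin 2 → B}, G (e 0) (e 1) →
      (γ.Sat T e ↔ γ.Sat J (π ∘ e)) := by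
    intro γ hγ e he
    cases hγ with
    | @eq z w => exact ⟨congrArg π, c.inj _ _ _ (c.refl _) (hG he z w)⟩
    | @bin R z w => exact (c.bin R _ _).trans (and_iff_left (hG he z w))
  induction hφ generalizing e with
  | falsum => rfl
  | eq z w => exact ⟨congrArg π, c.inj _ _ _ (c.refl _) (hG he z w)⟩
  | un P x => exact c.un P _
  | bin R z w => exact (c.bin R _ _).trans (and_iff_left (hG he z w))
  | neg _ ih => exact not_congr (ih he)
  | and _ _ ih₁ ih₂ => exact and_congr (ih₁ he) (ih₂ he)
  | @ex φ x _ hx ih =>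
    -- The new value need not be `G`-related to the old one; as `φ` has at most one free variable, a
    -- constant assignment serves instead.
    have key : ∀ a, φ.Sat T (update e x a) ↔ φ.Sat J (update (π ∘ e) x (π a)) := fun a =>
      (Formula.sat_update hx).trans
        ((ih (e := fun _ => a) (c.refl a)).trans (Formula.sat_update hx).symm)
    simp only [Sat, Nat.cast_one, Set.one_le_encard_iff_nonempty]
    constructor
    · rintro ⟨a, ha⟩
      exact ⟨π a, (key a).1 ha⟩
    · rintro ⟨b, hb⟩
      obtain ⟨a, rfl⟩ := c.surj b
      exact ⟨a, (key a).2 hb⟩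
  | @exGuarded γ φ n x hγ _ ih =>
    obtain ⟨y, hy⟩ : ∃ y, y ≠ x := exists_ne x
    have hup : ∀ a, G (e y) a → G (update e x a 0) (update e x a 1) := by
      intro a ha
      have : x = 0 ∧ y = 1 ∨ x = 1 ∧ y = 0 := by omega
      rcases this with ⟨rfl, rfl⟩ | ⟨rfl, rfl⟩
      · simpa using c.symm _ _ ha
      · simpa using ha
    have key : ∀ a, G (e y) a → ((Formula.and γ φ).Sat T (update e x a) ↔
        (Formula.and γ φ).Sat J (update (π ∘ e) x (π a))) := fun a ha => by
      rw [← hcomp]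
      exact and_congr (hatom hγ (hup a ha)) (ih (hup a ha))
    have hT : ∀ a, (Formula.and γ φ).Sat T (update e x a) → G (e y) a := fun a ha => by
      simpa [hy] using c.of_adj (hγ.of_sat ha.1 hy)
    -- The guard confines solutions in `T` to elements `G`-related to `e y`, and solutions in `J` to
    -- its image and neighbors, which lift. With injectivity there, the two solution sets have equal
    -- cardinality.
    have himg : π '' {a | (Formula.and γ φ).Sat T (update e x a)} =
        {b | (Formula.and γ φ).Sat J (update (π ∘ e) x b)} := by
      ext b
      constructor
      · rintro ⟨a, ha, rfl⟩
        exact (key a (hT a ha)).1 ha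
      · intro hb
        obtain ⟨a, rfl, ha⟩ := c.lift (e y) b (by simpa [hy] using hγ.of_sat hb.1 hy)
        exact ⟨a, (key a ha).2 hb, rfl⟩
    have hinj : Set.InjOn π {a | (Formula.and γ φ).Sat T (update e x a)} :=
      fun a ha b hb h => c.inj _ _ _ (hT a ha) (hT b hb) h
    change _ ≤ Set.encard _ ↔ _ ≤ Set.encard _
    rw [← himg, hinj.encard_image]

theorem Models.of_isGuardedCover {T : Interp σ B} {J : Interp σ A} {G : B → B → Prop} {π : B → A}
    (c : IsGuardedCover T J G π) {Θ : Set (Formula σ)} (hΘ : ∀ θ ∈ Θ, θ.IsGC2Sentence)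
    (h : Models J Θ) : Models T Θ := by
  intro θ hθ e
  -- The values of an arbitrary assignment need not be `G`-related, but a sentence allows a constant
  -- one.
  rw [Formula.sat_congr (e' := fun _ => e 0) θ (by simp [(hΘ θ hθ).2]),
    (hΘ θ hθ).1.sat_iff c (c.refl _)]
  exact h θ hθ _

theorem Atom.Holds.map {T : Interp σ B} {J : Interp σ A} {π : B → A} (h : IsHom T J π) {V : Type}
    {f : V → B} {α : Atom σ V} (hα : α.Holds T f) : α.Holds J (π ∘ f) := by
  cases α with
  | un P x => exact h.1 _ _ hα
  | bin R x y => exact h.2 _ _ _ hα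

theorem SatCQ.map {T : Interp σ B} {J : Interp σ A} {π : B → A} (h : IsHom T J π)
    {q : ConjAtoms σ} : SatCQ T q → SatCQ J q :=
  fun ⟨f, hf⟩ => ⟨π ∘ f, fun α hα => (hf α hα).map h⟩

end Formulas

/-! ## Cycles -/

/-- If every vertex of positive rank has at most one neighbor that is not of larger rank, all
vertices on cycles have rank zero. -/
theorem rank_eq_zero_of_isCycle {V : Type*} {G : SimpleGraph V} (r : V → ℕ)
    (h : ∀ x y z, 0 < r x → G.Adj x y → G.Adj x z → r y ≤ r x → r z ≤ r x → y = z)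
    {a : V} {p : G.Walk a a} (hp : p.IsCycle) {b : V} (hb : b ∈ p.support) : r b = 0 := by
  classical
  -- At a vertex of maximal rank, both neighbors along the cycle have no larger rank, so they would
  -- coincide. Rotation makes them the second and the penultimate vertex.
  obtain ⟨x, hx, hmax⟩ := p.support.toFinset.exists_max_image r ⟨b, by simpa using hb⟩
  simp only [List.mem_toFinset] at hx hmax
  by_contra hr
  have hpos : 0 < r x := (Nat.pos_of_ne_zero hr).trans_le (hmax b hb)
  have hc := hp.rotate hx
  have hmem : ∀ y ∈ (p.rotate x hx).support, r y ≤ r x :=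
    fun y hy => hmax y ((SimpleGraph.Walk.mem_support_rotate_iff _ _ hx).1 hy)
  refine hc.snd_ne_penultimate (h x _ _ hpos ?_ ?_ ?_ ?_)
  · exact SimpleGraph.Walk.adj_snd hc.not_nil
  · exact (SimpleGraph.Walk.adj_penultimate hc.not_nil).symm
  · exact hmem _ (SimpleGraph.Walk.getVert_mem_support _ _)
  · exact hmem _ (SimpleGraph.Walk.getVert_mem_support _ _)

/-! ### Adding and dropping the fresh relation -/

section Reduct

variable {σ : Signature.{u}} {A : Type v}

theorem Interp.reduct_gaifman_le (J : Interp σ.addBin A) : J.reduct.gaifman ≤ J.gaifman :=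
  fun _ _ ⟨hne, R, h⟩ => ⟨hne, some R, h⟩

variable {J : Interp σ.addBin A} {S : Set A}

theorem Interp.reduct_pathTree_cycleFreeExcept :
    (J.pathTree S).toInterp.reduct.CycleFreeExcept (Set.range (Path.base J S)) := by
  intro a p hp b hb
  refine Path.mem_root_iff.1 (.inr (.inr ⟨rfl, ?_⟩))
  have hpos := b.length_pos
  -- Subtracting one gives exactly the elements of the root bag rank zero.
  have := rank_eq_zero_of_isCycle (fun x : J.Path S => x.1.length - 1) ?_ hp hb
  · change b.1.length - 1 = 0 at this
    omega
  have key : ∀ x y : J.Path S, 0 < x.1.length - 1 →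
      (J.pathTree S).toInterp.reduct.gaifman.Adj x y → y.1.length - 1 ≤ x.1.length - 1 →
      y.1 = x.1.tail := by
    intro x y hx h hle
    have hy := y.length_pos
    rcases Path.cobag_iff.1 (pathTree_adj.1 (reduct_gaifman_le _ h)).2 with h' | h' | h' | h'
    · exact absurd h' h.ne
    · have := congrArg List.length h'
      rw [List.length_tail] at this
      omega
    · exact h'
    · omega
  exact fun x y z hx hy hz hyr hzr =>
    Subtype.ext ((key x y hx hy hyr).trans (key x z hx hz hzr).symm)

/-- The relation is that of sharing a bag, not adjacency in the reduct: it does not depend on the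
fresh relation, and it may relate more pairs than a cover needs. -/
theorem Interp.reduct_pathTree_isGuardedCover (hS : ∀ a, ∃ s ∈ S, J.gaifman.Reachable s a) :
    IsGuardedCover (J.pathTree S).toInterp.reduct J.reduct Path.Cobag Path.last where
  refl _ := Path.cobag_iff.2 (.inl rfl)
  symm _ _ := fun ⟨b, hx, hy⟩ => ⟨b, hy, hx⟩
  surj := Path.exists_last_eq hS
  inj _ _ _ := Path.cobag_unique
  lift x a h := by
    rcases h with rfl | h
    · exact ⟨x, rfl, Path.cobag_iff.2 (.inl rfl)⟩
    · exact x.exists_cobag (reduct_gaifman_le _ h)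
  un _ _ := pathTree_un
  bin _ _ _ := pathTree_bin

/-- The expansion of `J` by a relation that holds between `s` and every element. -/
def Interp.expandStar (J : Interp σ A) (s : A) : Interp σ.addBin A where
  un := J.un
  bin R a b := R.elim (a = s) fun R => J.bin R a b

theorem Interp.expandStar_reachable (J : Interp σ A) (s a : A) :
    (J.expandStar s).gaifman.Reachable s a := by
  by_cases h : s = a
  · exact h ▸ .refl _
  · exact SimpleGraph.Adj.reachable ⟨h, none, .inl rfl⟩

end Reduct

end GuardedUnraveling

theorem mainTheorem6 (σ : Signature.{u}) (Θ : Set (Formula σ))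
    (hΘ : ∀ θ ∈ Θ, θ.IsGC2Sentence) (q : ConjAtoms σ) (F : ConjAtoms σ) (hF : F.atoms ≠ [])
    {A : Type v} (J : Interp σ A) (hJΘ : Models J Θ) (hJq : ¬ SatCQ J q)
    (f : Fin F.n → A) (hf : IsWitness J F f) :
    ∃ (J' : Interp σ.addBin A) (B : Type v) (T : BagTree σ.addBin B) (ι : Set.range f → B),
      J'.reduct = J ∧
      T.IsFaithfulUnraveling J' (Set.range f) ι ∧
      Models T.toInterp.reduct Θ ∧
      ¬ SatCQ T.toInterp.reduct q ∧
      IsWitness T.toInterp.reduct F (fun x => ι ⟨f x, Set.mem_range_self x⟩) ∧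
      T.toInterp.reduct.CycleFreeExcept (Set.range ι) := by
  -- The fact is non-empty, so its witness supplies a center for the star.
  obtain ⟨x₀⟩ : Nonempty (Fin F.n) := by
    obtain ⟨α, -⟩ := List.exists_mem_of_ne_nil _ hF
    cases α with
    | un _ x => exact ⟨x⟩
    | bin _ x _ => exact ⟨x⟩
  have hS : ∀ a, ∃ s ∈ Set.range f, (J.expandStar (f x₀)).gaifman.Reachable s a :=
    fun a => ⟨f x₀, ⟨x₀, rfl⟩, J.expandStar_reachable _ a⟩
  have hc := Interp.reduct_pathTree_isGuardedCover hS
  refine ⟨J.expandStar (f x₀), _, (J.expandStar (f x₀)).pathTree (Set.range f),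
    Interp.Path.base _ _, rfl, ⟨_, _, Interp.pathTree_isFaithfulVia hS⟩,
    Models.of_isGuardedCover hc hΘ hJΘ, fun h => hJq (h.map (π := Interp.Path.last) ?_), fun α hα => ?_,
    Interp.reduct_pathTree_cycleFreeExcept⟩
  · exact ⟨fun P x => (hc.un P x).1, fun R x y h => ((hc.bin R x y).1 h).1⟩
  · have h := hf α hα
    cases α with
    | un P x => exact (hc.un _ _).2 h
    | bin R x y =>
      refine (hc.bin _ _ _).2 ⟨h, Interp.Path.cobag_iff.2 (.inr (.inr (.inr ⟨rfl, rfl⟩)))⟩
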